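/- **Setting.** Let $E$ be a finite-dimensional Euclidean space (e.g. $\mathbb R^{m\times n}$ with the Frobenius inner product, identified with $\mathbb R^{r}$, $r=mn$), let $\mathcal M\subseteq E$ be a smooth embedded submanifold that is closed in $E$, with the induced metric, and let $P_\theta$ be the orthogonal projection of $E$ onto $T_\theta\mathcal M$. Let $x_1,\dots,x_N$ be inputs and let each $f(x_i,\cdot)$ be an $\mathbb R^q$-valued map that is $C^1$ near every point of $\mathcal M$. Put $u(\theta)=(f(x_1,\theta),\dots,f(x_N,\theta))\in(\mathbb R^q)^N$. Its Riemannian Jacobian is $J^R(\theta)=\mathrm D u(\theta)\,P_\theta$ (its rows are the Riemannian gradients of the components of $u$). Fix $\theta^0\in\mathcal M$, put $u^0=u(\theta^0)$ and $\sigma_0=\sqrt{\lambda_{\min}(J^R(\theta^0)J^R(\theta^0)^\top)}$, and fix constants $\mu,\kappa_L,\kappa_H>0$. Norms of vectors are Euclidean, norms of matrices are operator norms. Let $p(\cdot\,|z)$, $z\in\mathbb R^q$, be a family of probability densities on $\mathbb R^q$ with respect to a reference measure, let $y=(y_1,\dots,y_N)\in(\mathbb R^q)^N$, and let $L(z,y_i)=-\log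 p(y_i|z)$. Consider the following assumptions on $p$ and $y$. 1. For every $i$: $p(y_i|z)>0$ for all $z$; $L(\cdot,y_i)$ is $C^2$ with $\mu I\preceq\nabla^2_{zz}L(z,y_i)\preceq\kappa_L I$ and $\|\nabla^2_{zz}L(z,y_i)-\nabla^2_{zz}L(w,y_i)\|\le\kappa_H\|z-w\|$ for all $z,w\in\mathbb R^q$; and $\nabla_zL(y_i,y_i)=0$. 2. For every $i$ and $\theta\in\mathcal M$, at $z=f(x_i,\theta)$, the Fisher information matrix $F_L(x_i,\theta)=\mathbb E_{y'\sim p(\cdot|z)}[\nabla_z\log p(y'|z)\,\nabla_z\log p(y'|z)^\top]$ equals $\nabla^2_{zz}L(z,y_i)$. 3. (Riemannian Jacobian stability) $\sigma_0>0$, and every $\theta\in\mathcal M$ with $\|\theta-\theta^0\|\le 4\kappa_L(\mu\sigma_0)^{-1}\|u^0-y\|$ satisfies $$\|J^R(\theta)-J^R(\theta^0)\|\le\min\Big\{\frac12,\frac{\mu}{6\kappa_L}\Big\}\sigma_0 .$$ The deterministic Riemannian natural gradient method (RNGD) with step size $t>0$ produces, from $\theta^0$, $$d^k=F^R(\theta^k)^\dagger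 J^R(\theta^k)^\top\nabla L(u^k,y),\qquad \theta^{k+1}=\mathrm{Exp}_{\theta^k}(-t\,d^k),\qquad u^k=u(\theta^k),$$ where $F^R(\theta)=J^R(\theta)^\top\mathrm{blkdiag}(F_L(x_1,\theta),\dots,F_L(x_N,\theta))J^R(\theta)$, ${}^\dagger$ is the Moore–Penrose inverse, $\nabla L(u,y)=(\nabla_zL(u_1,y_1),\dots,\nabla_zL(u_N,y_N))$ and $\mathrm{Exp}$ is the Riemannian exponential map of $\mathcal M$. **Theorem.** There is a constant $\kappa_R>0$, depending only on $\mathcal M$, $u(\cdot)$, $\theta^0$, $\mu$, $\kappa_L$ and $\kappa_H$, such that the following holds. (a) For all $p,y$ satisfying 1–3 with $\|u^0-y\|<\frac{\mu}{3\kappa_H}$, and all step sizes $$0<t\le\min\Big\{1,\Big(\frac1{6\|u^0-y\|}-\frac{\kappa_H}{2\mu}\Big)\cdot\frac{3\mu^2\sigma_0}{8\kappa_R\kappa_L^2}\Big\}\qquad(\text{only } 0<t\le1 \text{ is required if } u^0=y),$$ the RNGD iterates satisfy $\|u^{k+1}-y\|\le(1-\frac t2)\|u^k-y\|$ for all $k\ge0$.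 (b) Suppose in addition that $\|J^R(\theta)-J^R(\nu)\|\le\kappa_J\|\theta-\nu\|$ for all $\theta,\nu\in\mathcal M$. Then there is a constant $\kappa_q>0$, depending only on the data that determine $\kappa_R$ and on $\kappa_J$, such that for all $p,y$ satisfying 1–3 with $\|u^0-y\|<\frac{\mu}{3\kappa_H}$ for which $t=1$ is an admissible step size in (a), the RNGD iterates with $t=1$ satisfy $\|u^{k+1}-y\|\le\kappa_q\|u^k-y\|^2$ for all $k\ge0$. -/

import Mathlib

open MeasureTheory
open scoped ContDiff Gradient

noncomputable section

namespace RNGD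

section Manifold

variable {E : Type*} [NormedAddCommGroup E] [InnerProductSpace ℝ E]

/-- A smooth embedded submanifold of the Euclidean space `E` (of codimension `c`): near each of its
points it is the zero set of a smooth submersion to `ℝ^c`. -/
def IsEmbeddedSubmanifold (M : Set E) : Prop :=
  ∃ c : ℕ, ∀ θ ∈ M, ∃ (U : Set E) (h : E → EuclideanSpace ℝ (Fin c)),
    IsOpen U ∧ θ ∈ U ∧ ContDiffOn ℝ ∞ h U ∧
    (∀ z ∈ U, Function.Surjective (fderiv ℝ h z)) ∧ M ∩ U = {z ∈ U | h z = 0}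

/-- The tangent space `T_θ M`: the velocities at `θ` of the curves in `M` through `θ`. (For an
embedded submanifold these velocities already form a linear subspace.) -/
def tangentSpace (M : Set E) (θ : E) : Submodule ℝ E :=
  Submodule.span ℝ {v | ∃ γ : ℝ → E, (∀ s, γ s ∈ M) ∧ γ 0 = θ ∧ HasDerivAt γ v 0}

/-- Geodesics of `M` for the metric induced from `E`: curves in `M` whose ambient acceleration is
everywhere normal to `M`. -/
structure IsGeodesic (M : Set E) (c : ℝ → E) : Prop where
  contDiff : ContDiff ℝ 2 c
  mem : ∀ s, c s ∈ M
  normal : ∀ s, deriv (deriv c) s ∈ (tangentSpace M (c s))ᗮ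

/-- The graph of the Riemannian exponential map: `θ' = Exp_θ(ξ)`, i.e. `θ' = c(1)` for the geodesic
`c` of `M` with `c(0) = θ` and `c'(0) = ξ`. -/
def IsExp (M : Set E) (θ ξ θ' : E) : Prop :=
  ∃ c : ℝ → E, IsGeodesic M c ∧ c 0 = θ ∧ deriv c 0 = ξ ∧ c 1 = θ'

/-- The Riemannian Jacobian `J^R(θ)` of a map `g` on `M`: the Euclidean derivative composed with the
orthogonal projection onto `T_θ M`. Its rows are the Riemannian gradients
`P_{T_θ M} ∇g_j(θ)` of the components of `g`. -/
def riemJacobian [FiniteDimensional ℝ E] {G : Type*} [NormedAddCommGroup G] [NormedSpace ℝ G]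
    (M : Set E) (g : E → G) (θ : E) : E →L[ℝ] G :=
  (fderiv ℝ g θ).comp (tangentSpace M θ).starProjection

end Manifold

section LinearAlgebra

/-- The smallest eigenvalue of a (self-adjoint) operator. -/
def lambdaMin {G : Type*} [NormedAddCommGroup G] [NormedSpace ℝ G] (T : G →L[ℝ] G) : ℝ :=
  sInf {l : ℝ | Module.End.HasEigenvalue (T : G →ₗ[ℝ] G) l}

/-- `A` is the Moore-Penrose pseudo-inverse of the operator `F`. -/
structure IsPseudoInverse {E : Type*} [NormedAddCommGroup E] [InnerProductSpace ℝ E]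
    (F A : E →L[ℝ] E) : Prop where
  mul_mul_self : F.comp (A.comp F) = F
  mul_self_mul : A.comp (F.comp A) = A
  symm_left : (F.comp A : E →ₗ[ℝ] E).IsSymmetric
  symm_right : (A.comp F : E →ₗ[ℝ] E).IsSymmetric

end LinearAlgebra

/-- The output space `ℝ^q`. -/
abbrev Out (q : ℕ) : Type := EuclideanSpace ℝ (Fin q)

/-- The space `(ℝ^q)^N` of stacked outputs, with its Euclidean norm. -/
abbrev Stack (N q : ℕ) : Type := PiLp 2 (fun _ : Fin N => Out q)

/-- The block-diagonal operator `blkdiag(A_1, …, A_N)` on `(ℝ^q)^N`. -/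
def blkdiag {N q : ℕ} (A : Fin N → (Out q →L[ℝ] Out q)) : Stack N q →L[ℝ] Stack N q :=
  ((PiLp.continuousLinearEquiv 2 ℝ (fun _ : Fin N => Out q)).symm.toContinuousLinearMap.comp
    (ContinuousLinearMap.piMap A)).comp
    (PiLp.continuousLinearEquiv 2 ℝ (fun _ : Fin N => Out q)).toContinuousLinearMap

theorem blkdiag_apply {N q : ℕ} (A : Fin N → (Out q →L[ℝ] Out q)) (v : Stack N q) (i : Fin N) :
    blkdiag A v i = A i (v i) := rfl

section Loss

variable {q : ℕ}

/-- `p y z = p(y|z)` is, for every parameter `z`, a probability density in `y` with respect to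
the reference measure `ν`. -/
structure IsConditionalDensity (ν : Measure (Out q)) (p : Out q → Out q → ℝ) : Prop where
  nonneg : ∀ y z, 0 ≤ p y z
  integrable : ∀ z, Integrable (fun y => p y z) ν
  integral_eq_one : ∀ z, ∫ y, p y z ∂ν = 1

/-- The negative log-probability loss `L(z, y) = -log p(y|z)`. -/
def loss (p : Out q → Out q → ℝ) (z y : Out q) : ℝ := -Real.log (p y z)

/-- The gradient `∇_z L(z, y)`. -/
def lossGrad (p : Out q → Out q → ℝ) (z y : Out q) : Out q := ∇ (fun w => loss p w y) z

/-- The Hessian `∇²_{zz} L(z, y)`, as an operator. -/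
def lossHess (p : Out q → Out q → ℝ) (z y : Out q) : Out q →L[ℝ] Out q :=
  fderiv ℝ (fun w => lossGrad p w y) z

/-- The Fisher information matrix in the parameter `z`:
`E_{y ~ p(·|z)} [∇_z log p(y|z) ∇_z log p(y|z)ᵀ]`. -/
def fisher (ν : Measure (Out q)) (p : Out q → Out q → ℝ) (z : Out q) : Out q →L[ℝ] Out q :=
  ∫ y, p y z • InnerProductSpace.rankOne ℝ
    (∇ (fun w => Real.log (p y w)) z) (∇ (fun w => Real.log (p y w)) z) ∂ν

/-- Assumptions on the loss `L(·, y)` for one label `y`: it is smooth and `μ`-strongly convex, has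
`κL`-Lipschitz gradient and `κH`-Lipschitz Hessian, and (as befits a loss) it is stationary at
`z = y`. -/
structure IsRegularLoss (p : Out q → Out q → ℝ) (μ κL κH : ℝ) (y : Out q) : Prop where
  pos : ∀ z, 0 < p y z
  smooth : ContDiff ℝ 2 (fun z => loss p z y)
  strongly_convex : ∀ z v, μ * ‖v‖ ^ 2 ≤ inner ℝ (lossHess p z y v) v
  hess_le : ∀ z v, inner ℝ (lossHess p z y v) v ≤ κL * ‖v‖ ^ 2
  hess_lipschitz : ∀ z w, ‖lossHess p z y - lossHess p w y‖ ≤ κH * ‖z - w‖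
  grad_self : lossGrad p y y = 0

end Loss

section Method

variable {E : Type*} [NormedAddCommGroup E] [InnerProductSpace ℝ E] [FiniteDimensional ℝ E]
  {X : Type*} {N q : ℕ}

/-- The stacked outputs `u(θ) = (f(x_1, θ), …, f(x_N, θ))`. -/
def output (f : X → E → Out q) (x : Fin N → X) (θ : E) : Stack N q :=
  WithLp.toLp 2 (fun i => f (x i) θ)

/-- The Riemannian Fisher information matrix in the parameter `θ`,
`F^R(θ) = J^R(θ)ᵀ blkdiag(F_L(x_1, θ), …, F_L(x_N, θ)) J^R(θ)`, where `F_L(x_i, θ)` is the Fisher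
information matrix in the output variable at `f(x_i, θ)`. -/
def riemFisher (M : Set E) (ν : Measure (Out q)) (p : Out q → Out q → ℝ) (f : X → E → Out q)
    (x : Fin N → X) (θ : E) : E →L[ℝ] E :=
  (riemJacobian M (output f x) θ).adjoint.comp
    ((blkdiag (fun i => fisher ν p (f (x i) θ))).comp (riemJacobian M (output f x) θ))

/-- The stacked loss gradients `∇L(u, y) = (∇_z L(u_1, y_1), …, ∇_z L(u_N, y_N))`. -/
def stackGrad (p : Out q → Out q → ℝ) (u y : Stack N q) : Stack N q :=
  WithLp.toLp 2 (fun i => lossGrad p (u i) (y i))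

/-- The sequence `θ 0, θ 1, …` is generated by the deterministic Riemannian natural gradient method
with fixed step size `t`, using the exponential map as retraction:
`d^k = F^R(θ^k)^† J^R(θ^k)ᵀ ∇L(u^k, y)` and `θ^{k+1} = Exp_{θ^k}(-t d^k)`. -/
def IsRNGDSequence (M : Set E) (ν : Measure (Out q)) (p : Out q → Out q → ℝ) (f : X → E → Out q)
    (x : Fin N → X) (y : Stack N q) (t : ℝ) (θ : ℕ → E) : Prop :=
  ∀ k, ∃ A : E →L[ℝ] E, IsPseudoInverse (riemFisher M ν p f x (θ k)) A ∧
    IsExp M (θ k)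
      (-(t • A ((riemJacobian M (output f x) (θ k)).adjoint
        (stackGrad p (output f x (θ k)) y))))
      (θ (k + 1))

/-- `σ₀ = √(λ_min(J^R(θ⁰) J^R(θ⁰)ᵀ))`. -/
def sigmaZero (M : Set E) (f : X → E → Out q) (x : Fin N → X) (θ₀ : E) : ℝ :=
  √(lambdaMin ((riemJacobian M (output f x) θ₀).comp (riemJacobian M (output f x) θ₀).adjoint))

/-- The Riemannian Jacobian stability condition at `θ⁰` (operator norm). -/
structure IsJacobianStable (M : Set E) (f : X → E → Out q) (x : Fin N → X) (y : Stack N q)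
    (μ κL : ℝ) (θ₀ : E) : Prop where
  sigma_pos : 0 < sigmaZero M f x θ₀
  stable : ∀ θ ∈ M,
    ‖θ - θ₀‖ ≤ 4 * κL * (μ * sigmaZero M f x θ₀)⁻¹ * ‖output f x θ₀ - y‖ →
    ‖riemJacobian M (output f x) θ - riemJacobian M (output f x) θ₀‖
      ≤ min (1 / 2) (μ / (6 * κL)) * sigmaZero M f x θ₀

/-- The standing hypotheses of the local convergence analysis on the model `(ν, p)`, the labels
`y_1, …, y_N` and the starting point `θ⁰`. -/
structure Assumptions (M : Set E) (f : X → E → Out q) (x : Fin N → X) (θ₀ : E) (μ κL κH : ℝ)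
    (ν : Measure (Out q)) (p : Out q → Out q → ℝ) (y : Stack N q) : Prop where
  density : IsConditionalDensity ν p
  regular : ∀ i, IsRegularLoss p μ κL κH (y i)
  fisher_eq_hess : ∀ i, ∀ θ ∈ M, fisher ν p (f (x i) θ) = lossHess p (f (x i) θ) (y i)
  stable : IsJacobianStable M f x y μ κL θ₀

/-- The admissible step sizes: `0 < t ≤ min {1, (1/(6e) - κH/(2μ)) · 3μ²σ₀/(8 κR κL²)}` with initial
error `e = ‖u⁰ - y‖`, where `1/(6e)` is read as `+∞` if `e = 0`. -/
def StepSizeOK (μ κL κH κR σ₀ e t : ℝ) : Prop :=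
  0 < t ∧ t ≤ 1 ∧
    (e ≠ 0 → t ≤ (1 / (6 * e) - κH / (2 * μ)) * (3 * μ ^ 2 * σ₀ / (8 * κR * κL ^ 2)))

end Method

end RNGD

end

namespace RNGD

/-! ### Linear algebra: full-rank operators, smallest eigenvalue, pseudo-inverse. -/

section LinearAlgebra

variable {E : Type*} [NormedAddCommGroup E] [InnerProductSpace ℝ E] [FiniteDimensional ℝ E]
  {G : Type*} [NormedAddCommGroup G] [InnerProductSpace ℝ G] [FiniteDimensional ℝ G]

/-! In output space, RNGD is a damped Newton method up to controlled errors. Write `J` for the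
Riemannian Jacobian and `H` for the block Hessian of the loss, which equals the block Fisher matrix.
While `J` stays within `σ₀/6` of its initial value it has full row rank, so `d = F†Jᵀ∇L` satisfies
`H J d = ∇L` exactly (`apply_apply_pseudoInverse`). As `∇L` vanishes at `y` and `H` is Lipschitz, `J
d = (u - y) + O(‖u - y‖²)` (`norm_newton_sub_le`). Also `d ⟂ ker J`, whence `‖d‖ ≤ (2/σ₀)‖u - y‖`.

It remains to compare `u` along the geodesic with its linearisation. The velocity is tangent and of
constant norm, and the acceleration is at most `C‖c'‖²` over a compact part of `M`, so the error is
governed by the variation of `J` along the geodesic and by `C` (`IsGeodesic.norm_image_sub_sub_le`).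
Uniform continuity of `J` on that compact part gives a `δ` below which the error is at most
`(σ₀/12)‖ξ‖` for initial velocity `ξ`; `κR` is chosen so that admissible steps have length at most
`δ`.

For (a), the geodesic error costs `t/6`, the Newton error `t/3` and the undone part of the step `1 -
t`, with sum `1 - t/2`. The resulting geometric decay makes the step lengths summable, which keeps
the iterates in the ball where `J` is controlled. For (b), `t = 1` removes the last term, and
Lipschitz `J` makes the geodesic error quadratic in `‖ξ‖`. -/

theorem bijective_comp_adjoint {J : E →L[ℝ] G} {m : ℝ} (hm : 0 < m)
    (hJ : ∀ w, m * ‖w‖ ≤ ‖J.adjoint w‖) : Function.Bijective (J.comp J.adjoint) := by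
  have hinj : Function.Injective (J.comp J.adjoint : G →ₗ[ℝ] G) := by
    rw [← LinearMap.ker_eq_bot, LinearMap.ker_eq_bot']
    intro w hw
    have h0 : inner ℝ (J.adjoint w) (J.adjoint w) = 0 := by
      rw [ContinuousLinearMap.adjoint_inner_left]
      have hw' : J (J.adjoint w) = 0 := hw
      rw [hw', inner_zero_right]
    have h1 := hJ w
    rw [inner_self_eq_zero.mp h0, norm_zero] at h1
    have h2 : ‖w‖ ≤ 0 := by nlinarith [norm_nonneg w]
    exact norm_le_zero_iff.mp h2
  exact ⟨hinj, LinearMap.injective_iff_surjective.mp hinj⟩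

/-- A vector orthogonal to `ker J` is some `Jᵀw`, so `‖d‖² = ⟪w, J d⟫ ≤ ‖w‖‖J d‖` with `m‖w‖ ≤ ‖d‖`.
Used both for the length of the natural gradient direction and for the acceleration of geodesics. -/
theorem mul_norm_le_of_orthogonal_ker {J : E →L[ℝ] G} {m : ℝ} (hm : 0 < m)
    (hJ : ∀ w, m * ‖w‖ ≤ ‖J.adjoint w‖) {d : E} (hd : ∀ v, J v = 0 → inner ℝ d v = 0) :
    m * ‖d‖ ≤ ‖J d‖ := by
  obtain ⟨w, hw⟩ := (bijective_comp_adjoint hm hJ).2 (J d)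
  have hw' : J (J.adjoint w) = J d := hw
  have hk : J (d - J.adjoint w) = 0 := by rw [map_sub, hw', sub_self]
  have h1 := hd _ hk
  have h2 : inner ℝ (J.adjoint w) (d - J.adjoint w) = 0 := by
    rw [ContinuousLinearMap.adjoint_inner_left, hk, inner_zero_right]
  have h3 : d - J.adjoint w = 0 := by
    rw [← inner_self_eq_zero (𝕜 := ℝ), inner_sub_left, h1, h2, sub_zero]
  have h4 : d = J.adjoint w := sub_eq_zero.mp h3
  have h5 : ‖d‖ ^ 2 ≤ ‖w‖ * ‖J d‖ := by
    calc ‖d‖ ^ 2 = inner ℝ d d := (real_inner_self_eq_norm_sq d).symm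
      _ = inner ℝ (J.adjoint w) d := by rw [← h4]
      _ = inner ℝ w (J d) := ContinuousLinearMap.adjoint_inner_left _ _ _
      _ ≤ _ := real_inner_le_norm _ _
  have h6 : m * ‖w‖ ≤ ‖d‖ := by rw [h4]; exact hJ w
  rcases (norm_nonneg d).eq_or_lt with h | h
  · rw [← h, mul_zero]; exact norm_nonneg _
  · have h7 : m * ‖d‖ ^ 2 ≤ ‖d‖ * ‖J d‖ :=
      calc m * ‖d‖ ^ 2 ≤ m * (‖w‖ * ‖J d‖) := by gcongr
        _ = (m * ‖w‖) * ‖J d‖ := by ring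
        _ ≤ ‖d‖ * ‖J d‖ := by gcongr
    exact le_of_mul_le_mul_left (by linarith [h7, sq ‖d‖]) h

/-- A lower bound on the adjoint survives a small perturbation. -/
theorem lower_bound_adjoint_of_norm_sub_le {J J' : E →L[ℝ] G} {m η : ℝ}
    (hJ : ∀ w, m * ‖w‖ ≤ ‖J.adjoint w‖) (h : ‖J' - J‖ ≤ η) (w : G) :
    (m - η) * ‖w‖ ≤ ‖J'.adjoint w‖ := by
  have h1 : ‖J'.adjoint w - J.adjoint w‖ ≤ η * ‖w‖ := by
    rw [← sub_apply, ← map_sub]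
    refine (ContinuousLinearMap.le_opNorm _ _).trans ?_
    rw [LinearIsometryEquiv.norm_map]
    gcongr
  have h2 := norm_sub_norm_le (J.adjoint w) (J'.adjoint w)
  rw [norm_sub_rev] at h2
  linarith [hJ w]

theorem exists_lower_bound_adjoint {J : E →L[ℝ] G} (hJ : Function.Surjective J) :
    ∃ m > 0, ∀ w, m * ‖w‖ ≤ ‖J.adjoint w‖ := by
  have hker : (J.adjoint : G →ₗ[ℝ] E).ker = ⊥ := by
    rw [LinearMap.ker_eq_bot']
    intro w hw
    have hw' : J.adjoint w = 0 := hw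
    obtain ⟨v, hv⟩ := hJ w
    rw [← inner_self_eq_zero (𝕜 := ℝ)]
    nth_rw 2 [← hv]
    rw [← ContinuousLinearMap.adjoint_inner_left, hw', inner_zero_left]
  obtain ⟨K, hK, hanti⟩ := LinearMap.exists_antilipschitzWith _ hker
  refine ⟨(K : ℝ)⁻¹, by positivity, fun w => ?_⟩
  have h := hanti.le_mul_norm_sub w 0
  simp only [add_zero, norm_neg, map_zero] at h
  rw [inv_mul_le_iff₀ (by exact_mod_cast hK)]
  exact h

/-- On the zero space there are no eigenvalues and `sInf ∅ = 0`, so positivity excludes this case.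
-/
theorem exists_ne_zero_of_lambdaMin_pos
    {G : Type*} [NormedAddCommGroup G] [NormedSpace ℝ G] {T : G →L[ℝ] G} (hT : 0 < lambdaMin T) :
    ∃ w : G, w ≠ 0 := by
  by_contra! h
  have he : {l : ℝ | Module.End.HasEigenvalue (T : G →ₗ[ℝ] G) l} = ∅ := by
    ext l
    simp only [Set.mem_ofPred_eq, Set.mem_empty_iff_false, iff_false]
    intro hl
    obtain ⟨v, hv⟩ := hl.exists_hasEigenvector
    exact hv.2 (h v)
  rw [lambdaMin, he, Real.sInf_empty] at hT
  exact lt_irrefl _ hT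

/-- The infimum of the Rayleigh quotient of the symmetric operator `J Jᵀ` is itself an eigenvalue,
hence bounds `lambdaMin` from above. -/
theorem sqrt_lambdaMin_mul_norm_le (J : E →L[ℝ] G) (w : G) :
    √(lambdaMin (J.comp J.adjoint)) * ‖w‖ ≤ ‖J.adjoint w‖ := by
  set T : G →L[ℝ] G := J.comp J.adjoint with hT
  have hTw : ∀ v, inner ℝ (T v) v = ‖J.adjoint v‖ ^ 2 := fun v => by
    rw [← real_inner_self_eq_norm_sq, ContinuousLinearMap.adjoint_inner_right]
    rfl
  have hsymm : (T : G →ₗ[ℝ] G).IsSymmetric := fun v v' => by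
    change inner ℝ (J (J.adjoint v)) v' = inner ℝ v (J (J.adjoint v'))
    rw [← ContinuousLinearMap.adjoint_inner_right, ContinuousLinearMap.adjoint_inner_left]
  rcases eq_or_ne w 0 with rfl | hw
  · simp
  have : Nontrivial G := ⟨⟨w, 0, hw⟩⟩
  have hev := hsymm.hasEigenvalue_iInf_of_finiteDimensional
  have hbdd : BddBelow {l : ℝ | Module.End.HasEigenvalue (T : G →ₗ[ℝ] G) l} :=
    (Module.End.finite_hasEigenvalue (T : G →ₗ[ℝ] G)).bddBelow
  have h1 := csInf_le hbdd hev
  have h2 : (⨅ v : {v : G // v ≠ 0}, inner ℝ (T v) (v : G) / ‖(v : G)‖ ^ 2)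
      ≤ inner ℝ (T w) w / ‖w‖ ^ 2 := by
    refine ciInf_le ⟨0, ?_⟩ (⟨w, hw⟩ : {v : G // v ≠ 0})
    rintro _ ⟨v, rfl⟩
    simp only [hTw]
    positivity
  have hwpos : 0 < ‖w‖ := norm_pos_iff.mpr hw
  have h3 : lambdaMin T ≤ ‖J.adjoint w‖ ^ 2 / ‖w‖ ^ 2 := by
    rw [← hTw]
    exact h1.trans h2
  rw [← div_pow] at h3
  have h4 := Real.sqrt_le_sqrt h3
  rw [Real.sqrt_sq (by positivity), le_div_iff₀ hwpos] at h4
  exact h4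

/-- The direction `F^† Jᵀ g` solves the preconditioned normal equations exactly when `J` has full
row rank. -/
theorem apply_apply_pseudoInverse {J : E →L[ℝ] G} {H : G →L[ℝ] G} {A : E →L[ℝ] E} {m : ℝ}
    (hm : 0 < m) (hJ : ∀ w, m * ‖w‖ ≤ ‖J.adjoint w‖) (hH : Function.Injective H)
    (hA : IsPseudoInverse (J.adjoint.comp (H.comp J)) A) (g : G) :
    H (J (A (J.adjoint g))) = g := by
  have hadj : Function.Injective J.adjoint := by
    rw [injective_iff_map_eq_zero]
    intro w hw
    have h1 := hJ w
    rw [hw, norm_zero] at h1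
    exact norm_le_zero_iff.mp (by nlinarith [norm_nonneg w])
  have hsurj : Function.Surjective J := fun w => by
    obtain ⟨v, hv⟩ := (bijective_comp_adjoint hm hJ).2 w
    exact ⟨_, hv⟩
  have hHs : Function.Surjective H :=
    LinearMap.injective_iff_surjective (f := (H : G →ₗ[ℝ] G)).mp hH
  -- With `g = H J v`, the vector `Jᵀg` is `F v`, so `F A F = F` gives the claim after cancelling
  -- the injective `Jᵀ`.
  obtain ⟨w, rfl⟩ := hHs g
  obtain ⟨v, rfl⟩ := hsurj w
  have h := congrArg (fun L : E →L[ℝ] E => L v) hA.mul_mul_self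
  exact hadj h

/-- Since `A = (A F) A` with `A F` symmetric, pairing `A e` with `v` moves `A F` onto `v`, where `F
v = 0`. This makes the direction orthogonal to `ker J`. -/
theorem inner_pseudoInverse_eq_zero {J : E →L[ℝ] G} {H : G →L[ℝ] G} {A : E →L[ℝ] E}
    (hA : IsPseudoInverse (J.adjoint.comp (H.comp J)) A) (e v : E) (hv : J v = 0) :
    inner ℝ (A e) v = 0 := by
  have h1 : A (J.adjoint (H (J (A e)))) = A e :=
    congrArg (fun L : E →L[ℝ] E => L e) hA.mul_self_mul
  have h2 : inner ℝ (A (J.adjoint (H (J (A e))))) v = inner ℝ (A e) (A (J.adjoint (H (J v)))) :=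
    hA.symm_right (A e) v
  rw [h1, hv, map_zero, map_zero, map_zero, inner_zero_right] at h2
  exact h2

end LinearAlgebra

/-! ### The loss: Newton error and bounds on the Hessian. -/

section Loss

variable {q : ℕ} {p : Out q → Out q → ℝ} {μ κL κH : ℝ} {y : Out q}

theorem IsRegularLoss.mul_norm_le (h : IsRegularLoss p μ κL κH y) (z v : Out q) :
    μ * ‖v‖ ≤ ‖lossHess p z y v‖ := by
  rcases (norm_nonneg v).eq_or_lt with h0 | h0
  · rw [← h0, mul_zero]; exact norm_nonneg _
  · have h1 := (h.strongly_convex z v).trans (real_inner_le_norm _ _)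
    exact le_of_mul_le_mul_right (by linarith [h1, sq ‖v‖]) h0

theorem IsRegularLoss.differentiable_lossGrad (h : IsRegularLoss p μ κL κH y) :
    Differentiable ℝ (fun z => lossGrad p z y) := by
  have h1 : ContDiff ℝ 1 (fderiv ℝ (fun z => loss p z y)) :=
    h.smooth.fderiv_right (by norm_num)
  exact ((InnerProductSpace.toDual ℝ (Out q)).symm.toContinuousLinearEquiv.differentiable).comp
    (h1.differentiable (by norm_num))

/-- Mean value inequality on the segment from `y`, where the gradient vanishes, to `z`; the sharper
factor `1/2` is not needed. -/
theorem IsRegularLoss.norm_lossGrad_sub_le (h : IsRegularLoss p μ κL κH y) (hκH : 0 ≤ κH)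
    (z : Out q) :
    ‖lossGrad p z y - lossHess p z y (z - y)‖ ≤ κH * ‖z - y‖ ^ 2 := by
  have h1 := Convex.norm_image_sub_le_of_norm_fderiv_le' (𝕜 := ℝ) (f := fun w => lossGrad p w y)
    (C := κH * ‖z - y‖) (s := segment ℝ y z) (x := y) (y := z) (φ := lossHess p z y)
    (fun w _ => h.differentiable_lossGrad w) (fun w hw => ?_) (convex_segment y z)
    (left_mem_segment ℝ y z) (right_mem_segment ℝ y z)
  · rw [h.grad_self, sub_zero] at h1
    linarith [sq ‖z - y‖]
  · refine (h.hess_lipschitz w z).trans ?_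
    gcongr
    have := norm_sub_le_of_mem_segment (segment_symm ℝ y z ▸ hw)
    rwa [norm_sub_rev y z] at this

/-- The Newton direction for the loss approximates the error to second order. -/
theorem norm_newton_sub_le {N : ℕ} {y u h : Stack N q} (hμ : 0 < μ) (hκH : 0 < κH)
    (hreg : ∀ i, IsRegularLoss p μ κL κH (y i))
    (hh : blkdiag (fun i => lossHess p (u i) (y i)) h = stackGrad p u y) :
    ‖h - (u - y)‖ ≤ κH / μ * ‖u - y‖ ^ 2 := by
  have hi : ∀ i, ‖(h - (u - y)) i‖ ≤ κH / μ * ‖(u - y) i‖ ^ 2 := fun i => by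
    have h1 : lossHess p (u i) (y i) (h i) = lossGrad p (u i) (y i) :=
      congrArg (fun s : Stack N q => s i) hh
    have h2 := (hreg i).norm_lossGrad_sub_le hκH.le (u i)
    rw [← h1, ← map_sub] at h2
    have h3 := ((hreg i).mul_norm_le (u i) _).trans h2
    rw [div_mul_eq_mul_div, le_div_iff₀ hμ, mul_comm]
    exact h3
  have hsq : ‖h - (u - y)‖ ^ 2 ≤ (κH / μ * ‖u - y‖ ^ 2) ^ 2 := by
    calc ‖h - (u - y)‖ ^ 2 = ∑ i, ‖(h - (u - y)) i‖ ^ 2 := PiLp.norm_sq_eq_of_L2 _ _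
      _ ≤ ∑ i, (κH / μ) ^ 2 * (‖(u - y) i‖ ^ 2) ^ 2 := by
        gcongr with i
        rw [← mul_pow]
        gcongr
        exact hi i
      _ = (κH / μ) ^ 2 * ∑ i, (‖(u - y) i‖ ^ 2) ^ 2 := by rw [Finset.mul_sum]
      -- For nonnegative terms the sum of squares is at most the square of the sum, so the blockwise
      -- constant carries over without a factor `N`.
      _ ≤ (κH / μ) ^ 2 * (∑ i, ‖(u - y) i‖ ^ 2) ^ 2 := by
        gcongr
        exact Finset.sum_sq_le_sq_sum_of_nonneg fun i _ => by positivity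
      _ = (κH / μ * ‖u - y‖ ^ 2) ^ 2 := by rw [PiLp.norm_sq_eq_of_L2, mul_pow]
  exact le_of_sq_le_sq hsq (by positivity)

theorem blkdiag_lossHess_injective {N : ℕ} {y u : Stack N q} (hμ : 0 < μ)
    (hreg : ∀ i, IsRegularLoss p μ κL κH (y i)) :
    Function.Injective (blkdiag (fun i => lossHess p (u i) (y i))) := by
  rw [injective_iff_map_eq_zero]
  intro v hv
  ext1 i
  have h1 := (hreg i).mul_norm_le (u i) (v i)
  have h2 : lossHess p (u i) (y i) (v i) = 0 := congrArg (fun s : Stack N q => s i) hv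
  rw [h2, norm_zero] at h1
  exact norm_le_zero_iff.mp (by nlinarith [norm_nonneg (v i)])

theorem le_of_isRegularLoss {N : ℕ} {y : Stack N q}
    (hreg : ∀ i, IsRegularLoss p μ κL κH (y i)) {w : Stack N q} (hw : w ≠ 0) : μ ≤ κL := by
  obtain ⟨i, hi⟩ : ∃ i, w i ≠ 0 := by
    by_contra! h
    exact hw (by ext1 i; exact h i)
  have h1 := ((hreg i).strongly_convex 0 (w i)).trans ((hreg i).hess_le 0 (w i))
  have h2 : 0 < ‖w i‖ ^ 2 := by positivity
  exact le_of_mul_le_mul_right h1 h2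

end Loss

end RNGD

namespace RNGD

/-! ### Submanifolds: local defining functions, tangent spaces and projections. -/

section Manifold

variable {E : Type*} [NormedAddCommGroup E] [InnerProductSpace ℝ E]
  {G : Type*} [NormedAddCommGroup G] [InnerProductSpace ℝ G]

/-- `h` is a local defining function of `M` on the open set `U`. -/
structure IsDefiningOn (M U : Set E) (h : E → G) : Prop where
  isOpen : IsOpen U
  contDiffOn : ContDiffOn ℝ ∞ h U
  surjective : ∀ z ∈ U, Function.Surjective (fderiv ℝ h z)
  inter_eq : M ∩ U = {z ∈ U | h z = 0}

theorem IsEmbeddedSubmanifold.exists_isDefiningOn {M : Set E} (hM : IsEmbeddedSubmanifold M) :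
    ∃ c : ℕ, ∀ θ ∈ M, ∃ (U : Set E) (h : E → EuclideanSpace ℝ (Fin c)),
      θ ∈ U ∧ IsDefiningOn M U h := by
  obtain ⟨c, hc⟩ := hM
  refine ⟨c, fun θ hθ => ?_⟩
  obtain ⟨U, h, hU, hmem, hcd, hs, heq⟩ := hc θ hθ
  exact ⟨U, h, hmem, hU, hcd, hs, heq⟩

namespace IsGeodesic

variable {M : Set E} {c : ℝ → E}

theorem hasDerivAt (hc : IsGeodesic M c) (s : ℝ) : HasDerivAt c (deriv c s) s :=
  (hc.contDiff.differentiable (by norm_num) s).hasDerivAt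

theorem hasDerivAt_deriv (hc : IsGeodesic M c) (s : ℝ) :
    HasDerivAt (deriv c) (deriv (deriv c) s) s := by
  have h1 : ContDiff ℝ 1 (deriv c) := ContDiff.deriv' (n := 1) hc.contDiff
  exact (h1.differentiable (by norm_num) s).hasDerivAt

theorem deriv_mem_tangentSpace (hc : IsGeodesic M c) (s : ℝ) :
    deriv c s ∈ tangentSpace M (c s) := by
  refine Submodule.subset_span ⟨fun r => c (s + r), fun r => hc.mem _, by simp, ?_⟩
  have h1 : HasDerivAt c (deriv c s) (s + 0) := by simpa using hc.hasDerivAt s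
  exact h1.comp_const_add s 0

/-- The acceleration is normal and the velocity tangent, so `‖c'‖²` has derivative zero. -/
theorem norm_deriv_eq (hc : IsGeodesic M c) (s : ℝ) : ‖deriv c s‖ = ‖deriv c 0‖ := by
  have h1 : ∀ r, HasDerivAt (fun r => ‖deriv c r‖ ^ 2) 0 r := fun r => by
    have h2 := (hc.hasDerivAt_deriv r).norm_sq
    rwa [(Submodule.mem_orthogonal _ _).mp (hc.normal r) _ (hc.deriv_mem_tangentSpace r),
      mul_zero] at h2
  have h3 : ‖deriv c s‖ ^ 2 = ‖deriv c 0‖ ^ 2 :=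
    is_const_of_deriv_eq_zero (fun r => (h1 r).differentiableAt) (fun r => (h1 r).deriv) s 0
  exact (pow_left_inj₀ (norm_nonneg _) (norm_nonneg _) two_ne_zero).mp h3

theorem norm_sub_le (hc : IsGeodesic M c) {s : ℝ} (hs : s ∈ Set.Icc (0 : ℝ) 1) :
    ‖c s - c 0‖ ≤ ‖deriv c 0‖ := by
  have h1 := norm_image_sub_le_of_norm_deriv_le_segment' (f := c) (f' := deriv c) (a := 0) (b := 1)
    (C := ‖deriv c 0‖) (fun r _ => (hc.hasDerivAt r).hasDerivWithinAt)
    (fun r _ => (hc.norm_deriv_eq r).le) s hs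
  nlinarith [hs.1, hs.2, norm_nonneg (deriv c 0)]

end IsGeodesic

namespace IsDefiningOn

variable {M U : Set E} {h : E → G} {θ : E}

theorem eq_zero (H : IsDefiningOn M U h) (hθ : θ ∈ M) (hU : θ ∈ U) : h θ = 0 := by
  have h1 : θ ∈ M ∩ U := ⟨hθ, hU⟩
  rw [H.inter_eq] at h1
  exact h1.2

theorem mem (H : IsDefiningOn M U h) (hU : θ ∈ U) (h0 : h θ = 0) : θ ∈ M := by
  have h1 : θ ∈ {z ∈ U | h z = 0} := ⟨hU, h0⟩
  rw [← H.inter_eq] at h1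
  exact h1.1

theorem contDiffAt (H : IsDefiningOn M U h) (hU : θ ∈ U) : ContDiffAt ℝ ∞ h θ :=
  H.contDiffOn.contDiffAt (H.isOpen.mem_nhds hU)

theorem contDiffAt_fderiv (H : IsDefiningOn M U h) (hU : θ ∈ U) :
    ContDiffAt ℝ ∞ (fderiv ℝ h) θ :=
  (H.contDiffAt hU).fderiv_right (by norm_num)

theorem hasFDerivAt (H : IsDefiningOn M U h) (hU : θ ∈ U) :
    HasFDerivAt h (fderiv ℝ h θ) θ :=
  ((H.contDiffAt hU).differentiableAt (by norm_num)).hasFDerivAt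

theorem fderiv_apply_velocity (H : IsDefiningOn M U h) {γ : ℝ → E} {s : ℝ} {v : E}
    (hγ : ∀ r, γ r ∈ M) (hU : γ s ∈ U) (hv : HasDerivAt γ v s) : fderiv ℝ h (γ s) v = 0 := by
  have h1 := (H.hasFDerivAt hU).comp_hasDerivAt s hv
  have h2 : (h ∘ γ) =ᶠ[nhds s] fun _ => 0 := by
    filter_upwards [hv.continuousAt.preimage_mem_nhds (H.isOpen.mem_nhds hU)] with r hr
    exact H.eq_zero (hγ r) hr
  exact h1.unique ((hasDerivAt_const s (0 : G)).congr_of_eventuallyEq h2)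

variable [FiniteDimensional ℝ E] [FiniteDimensional ℝ G]

/-- Differentiating `h ∘ γ = 0` gives one inclusion; the implicit function theorem supplies a curve
in `M` for each kernel vector. -/
theorem tangentSpace_eq (H : IsDefiningOn M U h) (hθ : θ ∈ M) (hU : θ ∈ U) :
    tangentSpace M θ = (fderiv ℝ h θ : E →ₗ[ℝ] G).ker := by
  apply le_antisymm
  · rw [tangentSpace, Submodule.span_le]
    rintro v ⟨γ, hγ, rfl, hv⟩
    exact H.fderiv_apply_velocity hγ hU hv
  · intro v hv
    apply Submodule.subset_span
    have hs : HasStrictFDerivAt h (fderiv ℝ h θ) θ :=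
      (H.contDiffAt hU).hasStrictFDerivAt (by norm_num)
    have hr : (fderiv ℝ h θ : E →ₗ[ℝ] G).range = ⊤ :=
      LinearMap.range_eq_top.mpr (H.surjective θ hU)
    set φ := hs.implicitFunction h (fderiv ℝ h θ) hr (h θ) with hφ
    have hφ0 : φ 0 = θ := hs.implicitFunction_apply_image hr
    let k : (fderiv ℝ h θ : E →ₗ[ℝ] G).ker := ⟨v, hv⟩
    have hline : HasDerivAt (fun s : ℝ => s • k) k 0 := by
      simpa using (hasDerivAt_id (0 : ℝ)).smul_const k
    have hderiv : HasDerivAt (fun s : ℝ => φ (s • k)) v 0 := by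
      have h1 : HasFDerivAt φ (fderiv ℝ h θ : E →ₗ[ℝ] G).ker.subtypeL ((0 : ℝ) • k) := by
        rw [zero_smul]
        exact (hs.to_implicitFunction hr).hasFDerivAt
      exact h1.comp_hasDerivAt (0 : ℝ) hline
    have hmem : ∀ᶠ s : ℝ in nhds 0, φ (s • k) ∈ M := by
      have h1 : Filter.Tendsto (fun s : ℝ => (h θ, s • k)) (nhds 0) (nhds (h θ, 0)) := by
        have hc : Continuous fun s : ℝ => (h θ, s • k) := by fun_prop
        simpa using hc.tendsto 0
      have h2 := h1.eventually (hs.map_implicitFunction_eq hr)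
      have h3 : ∀ᶠ s : ℝ in nhds 0, φ (s • k) ∈ U := by
        refine hderiv.continuousAt.preimage_mem_nhds (H.isOpen.mem_nhds ?_)
        simpa [hφ0] using hU
      filter_upwards [h2, h3] with s hs2 hs3
      exact H.mem hs3 (hs2.trans (H.eq_zero hθ hU))
    classical
    -- The implicit curve lies in `M` only for small `s`, whereas the definition asks for all `s`;
    -- freezing it at `θ` elsewhere leaves the derivative at `0` unchanged.
    refine ⟨fun s => if φ (s • k) ∈ M then φ (s • k) else θ, fun s => ?_, ?_, ?_⟩
    · dsimp only
      split_ifs with hc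
      exacts [hc, hθ]
    · simp [hφ0]
    · refine hderiv.congr_of_eventuallyEq ?_
      filter_upwards [hmem] with s hs
      rw [if_pos hs]

/-- For surjective `A = Dh` the projection onto `ker A` is `1 - Aᵀ(A Aᵀ)⁻¹A`, which is continuous in
`A`. -/
theorem continuousAt_starProjection_ker (H : IsDefiningOn M U h) (hU : θ ∈ U) :
    ContinuousAt (fun z => (fderiv ℝ h z : E →ₗ[ℝ] G).ker.starProjection) θ := by
  set A : E → (E →L[ℝ] G) := fderiv ℝ h with hA
  have hbij : ∀ z ∈ U, IsUnit ((A z).comp (A z).adjoint) := fun z hz => by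
    obtain ⟨m, hm, hmz⟩ := exists_lower_bound_adjoint (H.surjective z hz)
    exact ContinuousLinearMap.isUnit_iff_bijective.mpr (bijective_comp_adjoint hm hmz)
  have hcA : ContinuousAt A θ := (H.contDiffAt_fderiv hU).continuousAt
  have hcadj : ContinuousAt (fun z => (A z).adjoint) θ :=
    (ContinuousLinearMap.adjoint (𝕜 := ℝ) (E := E) (F := G)).continuous.continuousAt.comp hcA
  have hcAA : ContinuousAt (fun z => (A z).comp (A z).adjoint) θ := hcA.clm_comp hcadj
  have hcinv : ContinuousAt (fun z => Ring.inverse ((A z).comp (A z).adjoint)) θ := by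
    obtain ⟨a, ha⟩ := hbij θ hU
    have h1 := NormedRing.inverse_continuousAt a
    rw [ha] at h1
    exact ContinuousAt.comp (f := fun z => (A z).comp (A z).adjoint) h1 hcAA
  have hform : ContinuousAt (fun z => ContinuousLinearMap.id ℝ E -
      (A z).adjoint.comp ((Ring.inverse ((A z).comp (A z).adjoint)).comp (A z))) θ :=
    continuousAt_const.sub (hcadj.clm_comp (hcinv.clm_comp hcA))
  refine hform.congr ?_
  filter_upwards [H.isOpen.mem_nhds hU] with z hz
  ext1 v
  symm
  apply Submodule.eq_starProjection_of_mem_orthogonal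
  · change A z (v - (A z).adjoint (Ring.inverse ((A z).comp (A z).adjoint) (A z v))) = 0
    have h1 : ((A z).comp (A z).adjoint) (Ring.inverse ((A z).comp (A z).adjoint) (A z v))
        = A z v :=
      congrArg (fun L : G →L[ℝ] G => L (A z v)) (Ring.mul_inverse_cancel _ (hbij z hz))
    have h2 : A z ((A z).adjoint (Ring.inverse ((A z).comp (A z).adjoint) (A z v))) = A z v := h1
    rw [map_sub, h2, sub_self]
  · rw [Submodule.mem_orthogonal]
    intro w hw
    have hw' : A z w = 0 := hw
    change inner ℝ w (v - (v - (A z).adjoint _)) = 0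
    rw [sub_sub_cancel, ContinuousLinearMap.adjoint_inner_right, hw', inner_zero_left]

end IsDefiningOn

variable [FiniteDimensional ℝ E]

theorem IsEmbeddedSubmanifold.continuousOn_starProjection {M : Set E}
    (hM : IsEmbeddedSubmanifold M) :
    ContinuousOn (fun θ => (tangentSpace M θ).starProjection) M := by
  obtain ⟨c, hc⟩ := hM.exists_isDefiningOn
  intro θ hθ
  obtain ⟨U, h, hU, H⟩ := hc θ hθ
  refine (H.continuousAt_starProjection_ker hU).continuousWithinAt.congr_of_eventuallyEq ?_ ?_
  · filter_upwards [self_mem_nhdsWithin, mem_nhdsWithin_of_mem_nhds (H.isOpen.mem_nhds hU)]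
      with z hz hzU
    simp only [H.tangentSpace_eq hz hzU]
  · simp only [H.tangentSpace_eq hθ hU]

theorem continuousOn_riemJacobian {F : Type*} [NormedAddCommGroup F] [NormedSpace ℝ F]
    {M : Set E} (hM : IsEmbeddedSubmanifold M) {g : E → F} (hg : ∀ θ ∈ M, ContDiffAt ℝ 1 g θ) :
    ContinuousOn (riemJacobian M g) M := fun θ hθ =>
  ContinuousWithinAt.clm_comp
    ((hg θ hθ).fderiv_right (m := 0) (by norm_num)).continuousAt.continuousWithinAt
    (hM.continuousOn_starProjection θ hθ)

/-! ### Curvature of geodesics and first order expansion along them. -/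

section Geodesic

variable {M : Set E} {c : ℝ → E}

/-- Geodesics through a compact part of `M` have uniformly bounded curvature. -/
theorem exists_geodesic_curvature_bound (hM : IsEmbeddedSubmanifold M) {K : Set E}
    (hK : IsCompact K) (hKM : K ⊆ M) :
    ∃ C ≥ 0, ∀ c : ℝ → E, IsGeodesic M c → ∀ s, c s ∈ K →
      ‖deriv (deriv c) s‖ ≤ C * ‖deriv c s‖ ^ 2 := by
  -- The bound passes to finite unions, so by compactness it suffices near each point.
  refine hK.induction_on (p := fun S => ∃ C ≥ 0, ∀ c : ℝ → E, IsGeodesic M c → ∀ s, c s ∈ S →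
      ‖deriv (deriv c) s‖ ≤ C * ‖deriv c s‖ ^ 2) ⟨0, le_rfl, fun _ _ _ h => h.elim⟩
    (fun S S' hS ⟨C, hC, h⟩ => ⟨C, hC, fun c hc s hs => h c hc s (hS hs)⟩) ?_ ?_
  · rintro S S' ⟨C, hC, h⟩ ⟨C', hC', h'⟩
    refine ⟨max C C', le_max_of_le_left hC, fun c hc s hs => ?_⟩
    rcases hs with hs | hs
    · exact (h c hc s hs).trans (by gcongr; exact le_max_left _ _)
    · exact (h' c hc s hs).trans (by gcongr; exact le_max_right _ _)
  · intro θ hθ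
    obtain ⟨n, hn⟩ := hM.exists_isDefiningOn
    obtain ⟨U, h, hU, H⟩ := hn θ (hKM hθ)
    obtain ⟨m, hm, hmw⟩ := exists_lower_bound_adjoint (H.surjective θ hU)
    have hD1 := H.contDiffAt_fderiv hU
    have hD2 : ContinuousAt (fun z => ‖fderiv ℝ (fderiv ℝ h) z‖) θ :=
      ContinuousAt.norm (E := E →L[ℝ] E →L[ℝ] EuclideanSpace ℝ (Fin n))
        (hD1.fderiv_right (m := 0) (by norm_num)).continuousAt
    have hnear1 : ∀ᶠ z in nhds θ, ‖fderiv ℝ h z - fderiv ℝ h θ‖ ≤ m / 2 := by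
      filter_upwards [Metric.tendsto_nhds.mp hD1.continuousAt (m / 2) (by positivity)] with z hz
      rw [← dist_eq_norm]
      exact hz.le
    have hnear2 : ∀ᶠ z in nhds θ,
        ‖fderiv ℝ (fderiv ℝ h) z‖ ≤ ‖fderiv ℝ (fderiv ℝ h) θ‖ + 1 := by
      filter_upwards [hD2.eventually_lt continuousAt_const (lt_add_one _)] with z hz
      exact hz.le
    refine ⟨{z | z ∈ U ∧ ‖fderiv ℝ h z - fderiv ℝ h θ‖ ≤ m / 2 ∧
      ‖fderiv ℝ (fderiv ℝ h) z‖ ≤ ‖fderiv ℝ (fderiv ℝ h) θ‖ + 1}, ?_,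
      (m / 2)⁻¹ * (‖fderiv ℝ (fderiv ℝ h) θ‖ + 1), by positivity, ?_⟩
    · exact mem_nhdsWithin_of_mem_nhds
        ((H.isOpen.eventually_mem hU).and (hnear1.and hnear2))
    · rintro c hc s ⟨hsU, hs1, hs2⟩
      -- Differentiating `Dh(c) c' = 0` gives `Dh(c) c'' = -D²h(c)(c', c')`. Since `c''` is
      -- orthogonal to `ker Dh(c)`, this determines and bounds it.
      have hcomp : HasDerivAt (fun r => fderiv ℝ h (c r))
          (fderiv ℝ (fderiv ℝ h) (c s) (deriv c s)) s :=
        ((H.contDiffAt_fderiv hsU).differentiableAt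
          (by norm_num)).hasFDerivAt.comp_hasDerivAt s (hc.hasDerivAt s)
      have h1 := hcomp.clm_apply (hc.hasDerivAt_deriv s)
      have h2 : (fun r => fderiv ℝ h (c r) (deriv c r)) =ᶠ[nhds s] fun _ => 0 := by
        filter_upwards [(hc.hasDerivAt s).continuousAt.preimage_mem_nhds
          (H.isOpen.mem_nhds hsU)] with r hr
        exact H.fderiv_apply_velocity hc.mem hr (hc.hasDerivAt r)
      have h3 := h1.unique ((hasDerivAt_const s _).congr_of_eventuallyEq h2)
      have h4 : ‖fderiv ℝ h (c s) (deriv (deriv c) s)‖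
          ≤ (‖fderiv ℝ (fderiv ℝ h) θ‖ + 1) * ‖deriv c s‖ ^ 2 := by
        rw [eq_neg_of_add_eq_zero_right h3, norm_neg]
        refine (ContinuousLinearMap.le_opNorm₂ _ _ _).trans ?_
        rw [mul_assoc, ← sq]
        gcongr
      have h5 : m / 2 * ‖deriv (deriv c) s‖ ≤ ‖fderiv ℝ h (c s) (deriv (deriv c) s)‖ := by
        refine mul_norm_le_of_orthogonal_ker (by positivity) (fun w => ?_) (fun v hv => ?_)
        · have := lower_bound_adjoint_of_norm_sub_le hmw hs1 w
          linarith
        · have hv' : v ∈ tangentSpace M (c s) := by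
            rw [H.tangentSpace_eq (hc.mem s) hsU]
            exact hv
          exact (Submodule.mem_orthogonal' _ _).mp (hc.normal s) v hv'
      rw [mul_assoc, le_inv_mul_iff₀ (by positivity)]
      exact h5.trans h4

/-- First order expansion along a geodesic of a map on `M`. -/
theorem IsGeodesic.norm_image_sub_sub_le {F : Type*} [NormedAddCommGroup F] [NormedSpace ℝ F]
    (hc : IsGeodesic M c) {g : E → F} (hg : ∀ θ ∈ M, ContDiffAt ℝ 1 g θ) {B C ε : ℝ}
    (hB : ‖riemJacobian M g (c 0)‖ ≤ B) (hC : 0 ≤ C)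
    (hcurv : ∀ s ∈ Set.Icc (0 : ℝ) 1, ‖deriv (deriv c) s‖ ≤ C * ‖deriv c s‖ ^ 2)
    (hε : ∀ s ∈ Set.Icc (0 : ℝ) 1, ‖riemJacobian M g (c s) - riemJacobian M g (c 0)‖ ≤ ε) :
    ‖g (c 1) - g (c 0) - riemJacobian M g (c 0) (deriv c 0)‖
      ≤ (ε + B * C * ‖deriv c 0‖) * ‖deriv c 0‖ := by
  set ξ := deriv c 0 with hξ
  set J := riemJacobian M g with hJ
  have hvel : ∀ s ∈ Set.Icc (0 : ℝ) 1, ‖deriv c s - ξ‖ ≤ C * ‖ξ‖ ^ 2 := fun s hs => by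
    have h1 := norm_image_sub_le_of_norm_deriv_le_segment' (f := deriv c) (f' := deriv (deriv c))
      (a := 0) (b := 1) (C := C * ‖ξ‖ ^ 2)
      (fun r _ => (hc.hasDerivAt_deriv r).hasDerivWithinAt)
      (fun r hr => by
        rw [hξ, ← hc.norm_deriv_eq r]
        exact hcurv r ⟨hr.1, hr.2.le⟩) s hs
    refine h1.trans (mul_le_of_le_one_right (by positivity) ?_)
    linarith [hs.2]
  -- The velocity is tangent, so the projection inside `J` does nothing to it; subtracting the
  -- linear part leaves a function whose derivative is small on `[0, 1]`.
  have hder : ∀ s, HasDerivAt (fun r => g (c r) - r • J (c 0) ξ)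
      (J (c s) (deriv c s) - J (c 0) ξ) s := fun s => by
    have h1 : HasDerivAt (fun r => g (c r)) (J (c s) (deriv c s)) s := by
      have h2 := ((hg _ (hc.mem s)).differentiableAt
        (by norm_num)).hasFDerivAt.comp_hasDerivAt s (hc.hasDerivAt s)
      have h3 : (tangentSpace M (c s)).starProjection (deriv c s) = deriv c s :=
        Submodule.starProjection_eq_self_iff.mpr (hc.deriv_mem_tangentSpace s)
      have h4 : J (c s) (deriv c s) = fderiv ℝ g (c s) (deriv c s) := by
        rw [hJ, riemJacobian, ContinuousLinearMap.comp_apply, h3]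
      rw [h4]
      exact h2
    have h5 : HasDerivAt (fun r : ℝ => r • J (c 0) ξ) (J (c 0) ξ) s := by
      simpa using (hasDerivAt_id s).smul_const (J (c 0) ξ)
    exact h1.sub h5
  have hmv := norm_image_sub_le_of_norm_deriv_le_segment_01'
    (C := (ε + B * C * ‖ξ‖) * ‖ξ‖)
    (fun s _ => (hder s).hasDerivWithinAt) (fun s hs => ?_)
  · simp only [one_smul, zero_smul, sub_zero] at hmv
    rwa [sub_right_comm]
  · have hs' : s ∈ Set.Icc (0 : ℝ) 1 := ⟨hs.1, hs.2.le⟩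
    have hsplit : J (c s) (deriv c s) - J (c 0) ξ
        = (J (c s) - J (c 0)) (deriv c s) + J (c 0) (deriv c s - ξ) := by
      rw [sub_apply, map_sub]
      abel
    have hB0 : 0 ≤ B := (norm_nonneg _).trans hB
    calc ‖J (c s) (deriv c s) - J (c 0) ξ‖
        ≤ ‖J (c s) - J (c 0)‖ * ‖deriv c s‖ + ‖J (c 0)‖ * ‖deriv c s - ξ‖ := by
          rw [hsplit]
          exact (norm_add_le _ _).trans (add_le_add (ContinuousLinearMap.le_opNorm _ _)
            (ContinuousLinearMap.le_opNorm _ _))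
      _ ≤ ε * ‖ξ‖ + B * (C * ‖ξ‖ ^ 2) := by
          have hε0 : 0 ≤ ε := (norm_nonneg _).trans (hε s hs')
          gcongr
          · exact hε s hs'
          · exact (hc.norm_deriv_eq s).le
          · exact hvel s hs'
      _ = (ε + B * C * ‖ξ‖) * ‖ξ‖ := by ring

end Geodesic

end Manifold

end RNGD

namespace RNGD

/-! ### Analysis of the RNGD iteration. -/

section Convergence

variable {E : Type*} [NormedAddCommGroup E] [InnerProductSpace ℝ E] [FiniteDimensional ℝ E]
  {X : Type*} {N q : ℕ} {M : Set E} {f : X → E → Out q} {x : Fin N → X} {θ₀ : E}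
  {μ κL κH : ℝ} {ν : Measure (Out q)} {p : Out q → Out q → ℝ} {y : Stack N q}

theorem contDiffAt_output {E : Type*} [NormedAddCommGroup E] [InnerProductSpace ℝ E]
    {f : X → E → Out q} {θ : E} (hf : ∀ i, ContDiffAt ℝ 1 (f (x i)) θ) :
    ContDiffAt ℝ 1 (output f x) θ :=
  (contDiffAt_piLp 2).mpr hf

theorem Assumptions.mu_le (ha : Assumptions M f x θ₀ μ κL κH ν p y) : μ ≤ κL := by
  obtain ⟨w, hw⟩ := exists_ne_zero_of_lambdaMin_pos (Real.sqrt_pos.mp ha.stable.sigma_pos)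
  exact le_of_isRegularLoss ha.regular hw

/-- Because `μ ≤ κL`, the stability ball contains the ball of radius `4e/σ₀`, and the stability
bound is at most `σ₀/6`. -/
theorem Assumptions.norm_riemJacobian_sub_le (hμ : 0 < μ)
    (ha : Assumptions M f x θ₀ μ κL κH ν p y) {θ : E} (hθ : θ ∈ M)
    (hnear : ‖θ - θ₀‖ ≤ 4 / sigmaZero M f x θ₀ * ‖output f x θ₀ - y‖) :
    ‖riemJacobian M (output f x) θ - riemJacobian M (output f x) θ₀‖
      ≤ 1 / 6 * sigmaZero M f x θ₀ := by
  have hS := ha.stable.sigma_pos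
  have hle := ha.mu_le
  have hκL : 0 < κL := hμ.trans_le hle
  refine (ha.stable.stable θ hθ (hnear.trans ?_)).trans ?_
  · gcongr
    rw [← div_eq_mul_inv, div_le_div_iff₀ hS (by positivity)]
    nlinarith
  · gcongr
    refine (min_le_right _ _).trans ?_
    rw [div_le_div_iff₀ (by positivity) (by norm_num)]
    linarith

/-- The step of the method at a point where the Jacobian is still controlled: it follows a geodesic
whose initial velocity is short and nearly solves the linearised equation `J ξ = -t (u - y)`. -/
theorem Assumptions.exists_geodesic_of_step (hμ : 0 < μ) (hκH : 0 < κH)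
    (ha : Assumptions M f x θ₀ μ κL κH ν p y) {θ θ' : E} (hθ : θ ∈ M)
    (hnear : ‖θ - θ₀‖ ≤ 4 / sigmaZero M f x θ₀ * ‖output f x θ₀ - y‖)
    (hsmall : κH / μ * ‖output f x θ - y‖ ≤ 1 / 3) {t : ℝ} (ht : 0 < t) {A : E →L[ℝ] E}
    (hA : IsPseudoInverse (riemFisher M ν p f x θ) A)
    (hexp : IsExp M θ (-(t • A ((riemJacobian M (output f x) θ).adjoint
        (stackGrad p (output f x θ) y)))) θ') :
    ∃ c : ℝ → E, IsGeodesic M c ∧ c 0 = θ ∧ c 1 = θ' ∧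
      ‖deriv c 0‖ ≤ 2 / sigmaZero M f x θ₀ * (t * ‖output f x θ - y‖) ∧
      ‖riemJacobian M (output f x) θ (deriv c 0) + t • (output f x θ - y)‖
        ≤ t * (κH / μ * ‖output f x θ - y‖ ^ 2) := by
  obtain ⟨c, hc, hc0, hc', hc1⟩ := hexp
  refine ⟨c, hc, hc0, hc1, ?_⟩
  rw [hc']
  set S := sigmaZero M f x θ₀
  have hS : 0 < S := ha.stable.sigma_pos
  set J := riemJacobian M (output f x) θ with hJ
  set u := output f x θ with hu
  set d := A (J.adjoint (stackGrad p u y)) with hd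
  have hJw : ∀ w, 5 / 6 * S * ‖w‖ ≤ ‖J.adjoint w‖ := fun w => by
    have h1 := lower_bound_adjoint_of_norm_sub_le
      (sqrt_lambdaMin_mul_norm_le (riemJacobian M (output f x) θ₀))
      (ha.norm_riemJacobian_sub_le hμ hθ hnear) w
    have h2 : 5 / 6 * S * ‖w‖ = (S - 1 / 6 * S) * ‖w‖ := by ring
    rw [h2]
    exact h1
  have hblk : (fun i => fisher ν p (f (x i) θ)) = fun i => lossHess p (u i) (y i) :=
    funext fun i => ha.fisher_eq_hess i θ hθ
  have hA' : IsPseudoInverse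
      (J.adjoint.comp ((blkdiag fun i => lossHess p (u i) (y i)).comp J)) A := by
    rw [← hblk]
    exact hA
  have hnewton : ‖J d - (u - y)‖ ≤ κH / μ * ‖u - y‖ ^ 2 :=
    norm_newton_sub_le hμ hκH ha.regular (apply_apply_pseudoInverse (by positivity) hJw
      (blkdiag_lossHess_injective hμ ha.regular) hA' _)
  -- The Newton error is at most a third of `‖u - y‖`. Dividing by the lower bound `5S/6` then gives
  -- `‖d‖ ≤ 8/(5S) ‖u - y‖`, rounded up to `2/S`.
  have hJd : ‖J d‖ ≤ 4 / 3 * ‖u - y‖ := by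
    have h1 := norm_le_norm_add_norm_sub' (J d) (u - y)
    nlinarith [norm_nonneg (u - y)]
  have hdn : ‖d‖ ≤ 2 / S * ‖u - y‖ := by
    have h1 := mul_norm_le_of_orthogonal_ker (by positivity) hJw
      (d := d) (fun v hv => inner_pseudoInverse_eq_zero hA' _ v hv)
    rw [div_mul_eq_mul_div, le_div_iff₀ hS]
    linarith [norm_nonneg (u - y)]
  constructor
  · rw [norm_neg, norm_smul, Real.norm_of_nonneg ht.le]
    calc t * ‖d‖ ≤ t * (2 / S * ‖u - y‖) := by gcongr
      _ = _ := by ring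
  · have h1 : J (-(t • d)) + t • (u - y) = -(t • (J d - (u - y))) := by
      rw [map_neg, map_smul]
      module
    rw [h1, norm_neg, norm_smul, Real.norm_of_nonneg ht.le]
    gcongr

/-- Along geodesics starting in a bounded part of a closed submanifold, a `C¹` map has a uniform
first order expansion. -/
theorem exists_geodesic_expansion (hM : IsEmbeddedSubmanifold M) (hM_closed : IsClosed M)
    {F : Type*} [NormedAddCommGroup F] [NormedSpace ℝ F] {g : E → F}
    (hg : ∀ θ ∈ M, ContDiffAt ℝ 1 g θ) (θ₀ : E) (R : ℝ) :
    ∃ C ≥ 0, ∀ ε > 0, ∃ δ > 0, ∀ c : ℝ → E, IsGeodesic M c →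
      ‖c 0 - θ₀‖ ≤ R → ‖deriv c 0‖ ≤ δ →
      (∀ s ∈ Set.Icc (0 : ℝ) 1, ‖riemJacobian M g (c s) - riemJacobian M g (c 0)‖ ≤ ε) ∧
      ∀ s ∈ Set.Icc (0 : ℝ) 1, ‖deriv (deriv c) s‖ ≤ C * ‖deriv c s‖ ^ 2 := by
  set K := M ∩ Metric.closedBall θ₀ (R + 1)
  have hK : IsCompact K := (isCompact_closedBall θ₀ (R + 1)).inter_left hM_closed
  obtain ⟨C, hC, hcurv⟩ := exists_geodesic_curvature_bound hM hK Set.inter_subset_left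
  refine ⟨C, hC, fun ε hε => ?_⟩
  have huc := hK.uniformContinuousOn_of_continuous
    ((continuousOn_riemJacobian hM hg).mono Set.inter_subset_left)
  obtain ⟨δ, hδ, hδK⟩ := Metric.uniformContinuousOn_iff.mp huc ε hε
  -- The bound `1` keeps the geodesic inside the ball of radius `R + 1`; halving `δ` provides the
  -- strict inequality of uniform continuity.
  refine ⟨min (δ / 2) 1, by positivity, fun c hc h0 hξ => ?_⟩
  have hmem : ∀ s ∈ Set.Icc (0 : ℝ) 1, c s ∈ K := fun s hs => by
    refine ⟨hc.mem s, ?_⟩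
    rw [mem_closedBall_iff_norm]
    calc ‖c s - θ₀‖ ≤ ‖c s - c 0‖ + ‖c 0 - θ₀‖ := norm_sub_le_norm_sub_add_norm_sub _ _ _
      _ ≤ R + 1 := by linarith [hc.norm_sub_le hs, hξ.trans (min_le_right _ _)]
  refine ⟨fun s hs => ?_, fun s hs => hcurv c hc s (hmem s hs)⟩
  rw [← dist_eq_norm]
  refine (hδK _ (hmem s hs) _ (hmem 0 ⟨le_rfl, zero_le_one⟩) ?_).le
  rw [dist_eq_norm]
  linarith [hc.norm_sub_le hs, hξ.trans (min_le_left _ _)]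

/-- The iterates stay near `θ⁰` and their errors decay geometrically, provided that outputs expand
well along short geodesics. -/
theorem Assumptions.linear_convergence (hμ : 0 < μ) (hκH : 0 < κH)
    (ha : Assumptions M f x θ₀ μ κL κH ν p y) (hθ₀ : θ₀ ∈ M)
    (he₀ : ‖output f x θ₀ - y‖ < μ / (3 * κH)) {δ t : ℝ} (ht : 0 < t) (ht1 : t ≤ 1)
    (hexpand : ∀ c : ℝ → E, IsGeodesic M c →
      ‖c 0 - θ₀‖ ≤ 4 / sigmaZero M f x θ₀ * ‖output f x θ₀ - y‖ → ‖deriv c 0‖ ≤ δ →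
      ‖output f x (c 1) - output f x (c 0) - riemJacobian M (output f x) (c 0) (deriv c 0)‖
        ≤ sigmaZero M f x θ₀ / 12 * ‖deriv c 0‖)
    (hδ : 2 / sigmaZero M f x θ₀ * (t * ‖output f x θ₀ - y‖) ≤ δ)
    {θ : ℕ → E} (h0 : θ 0 = θ₀) (hseq : IsRNGDSequence M ν p f x y t θ) (k : ℕ) :
    θ k ∈ M ∧ ‖output f x (θ k) - y‖ ≤ ‖output f x θ₀ - y‖ ∧
      ‖θ k - θ₀‖ ≤ 4 / sigmaZero M f x θ₀ * ‖output f x θ₀ - y‖ ∧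
      ‖output f x (θ (k + 1)) - y‖ ≤ (1 - t / 2) * ‖output f x (θ k) - y‖ := by
  set S := sigmaZero M f x θ₀
  have hS : 0 < S := ha.stable.sigma_pos
  set e₀ := ‖output f x θ₀ - y‖ with he₀def
  set r := 1 - t / 2 with hr
  have hr0 : 0 ≤ r := by linarith
  have hr1 : r ≤ 1 := by linarith
  have he₀n : 0 ≤ e₀ := norm_nonneg _
  have hpow1 : ∀ k, r ^ k ≤ 1 := fun k => pow_le_one₀ hr0 hr1
  have hrad : ∀ k, 4 / S * e₀ * (1 - r ^ k) ≤ 4 / S * e₀ := fun k =>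
    mul_le_of_le_one_right (by positivity) (by linarith [pow_nonneg hr0 k])
  have hstep : ∀ k, θ k ∈ M → ‖θ k - θ₀‖ ≤ 4 / S * e₀ → ‖output f x (θ k) - y‖ ≤ e₀ →
      θ (k + 1) ∈ M ∧ ‖θ (k + 1) - θ k‖ ≤ 2 / S * (t * ‖output f x (θ k) - y‖) ∧
      ‖output f x (θ (k + 1)) - y‖ ≤ r * ‖output f x (θ k) - y‖ := by
    intro k hk hnear hek
    have hsmall : κH / μ * ‖output f x (θ k) - y‖ ≤ 1 / 3 := by
      rw [lt_div_iff₀ (by positivity)] at he₀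
      rw [div_mul_eq_mul_div, div_le_iff₀ hμ]
      nlinarith
    obtain ⟨A, hA, hexp⟩ := hseq k
    obtain ⟨c, hc, hc0, hc1, hξ, hlin⟩ :=
      ha.exists_geodesic_of_step hμ hκH hk hnear hsmall ht hA hexp
    have hξδ : ‖deriv c 0‖ ≤ δ := hξ.trans (le_trans (by gcongr) hδ)
    have hE := hexpand c hc (by rwa [hc0]) hξδ
    have hmove := hc.norm_sub_le (s := 1) ⟨zero_le_one, le_rfl⟩
    rw [hc0, hc1] at hE hmove
    refine ⟨hc1 ▸ hc.mem 1, hmove.trans hξ, ?_⟩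
    set u := output f x (θ k)
    set u' := output f x (θ (k + 1))
    set J := riemJacobian M (output f x) (θ k)
    have hsplit : u' - y = (u' - u - J (deriv c 0)) + (J (deriv c 0) + t • (u - y))
        + (1 - t) • (u - y) := by
      rw [sub_smul, one_smul]
      abel
    have h1 : S / 12 * ‖deriv c 0‖ ≤ t / 6 * ‖u - y‖ :=
      calc S / 12 * ‖deriv c 0‖ ≤ S / 12 * (2 / S * (t * ‖u - y‖)) := by gcongr
        _ = t / 6 * ‖u - y‖ := by field_simp; ring
    have h2 : t * (κH / μ * ‖u - y‖ ^ 2) ≤ t / 3 * ‖u - y‖ :=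
      calc t * (κH / μ * ‖u - y‖ ^ 2) = t * (κH / μ * ‖u - y‖) * ‖u - y‖ := by ring
        _ ≤ t * (1 / 3) * ‖u - y‖ := by gcongr
        _ = t / 3 * ‖u - y‖ := by ring
    calc ‖u' - y‖ ≤ ‖u' - u - J (deriv c 0)‖ + ‖J (deriv c 0) + t • (u - y)‖
          + ‖(1 - t) • (u - y)‖ := by rw [hsplit]; exact norm_add₃_le
      _ ≤ t / 6 * ‖u - y‖ + t / 3 * ‖u - y‖ + (1 - t) * ‖u - y‖ := by
        gcongr
        · exact hE.trans h1
        · exact hlin.trans h2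
        · rw [norm_smul, Real.norm_of_nonneg (by linarith)]
      _ = r * ‖u - y‖ := by rw [hr]; ring
  -- The distance bound is the partial sum of the step lengths `(2/S) t rʲ e₀`, since `1 - r = t/2`.
  have hinv : ∀ k, θ k ∈ M ∧ ‖output f x (θ k) - y‖ ≤ r ^ k * e₀ ∧
      ‖θ k - θ₀‖ ≤ 4 / S * e₀ * (1 - r ^ k) := by
    intro k
    induction k with
    | zero => simp [h0, hθ₀, ← he₀def]
    | succ k ih =>
      obtain ⟨hk, hek, hnear⟩ := ih
      obtain ⟨h1, h2, h3⟩ := hstep k hk (hnear.trans (hrad k))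
        (hek.trans (mul_le_of_le_one_left he₀n (hpow1 k)))
      refine ⟨h1, ?_, ?_⟩
      · calc _ ≤ r * ‖output f x (θ k) - y‖ := h3
          _ ≤ r * (r ^ k * e₀) := by gcongr
          _ = r ^ (k + 1) * e₀ := by ring
      · calc ‖θ (k + 1) - θ₀‖ ≤ ‖θ (k + 1) - θ k‖ + ‖θ k - θ₀‖ :=
            norm_sub_le_norm_sub_add_norm_sub _ _ _
          _ ≤ 2 / S * (t * (r ^ k * e₀)) + 4 / S * e₀ * (1 - r ^ k) :=
            add_le_add (h2.trans (by gcongr)) hnear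
          _ = 4 / S * e₀ * (1 - r ^ (k + 1)) := by
            rw [show t = 2 * (1 - r) by rw [hr]; ring]
            ring
  obtain ⟨hk, hek, hnear⟩ := hinv k
  have hek' := hek.trans (mul_le_of_le_one_left he₀n (hpow1 k))
  have hnear' := hnear.trans (hrad k)
  exact ⟨hk, hek', hnear', (hstep k hk hnear' hek').2.2⟩

/-- Admissible step sizes keep the first step short. -/
theorem StepSizeOK.step_length_le {κR S e t δ : ℝ} (hμ : 0 < μ) (hκL : 0 < κL) (hκH : 0 < κH)
    (hS : 0 < S) (hδ : 0 < δ) (he : 0 ≤ e) (hκR : κR = μ ^ 2 / (8 * κL ^ 2 * δ))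
    (h : StepSizeOK μ κL κH κR S e t) : 2 / S * (t * e) ≤ δ := by
  rcases he.eq_or_lt with rfl | he'
  · simpa using hδ.le
  have h1 := h.2.2 he'.ne'
  -- The choice of `κR` cancels `μ` and `κL`; dropping the negative `κH` term then leaves `t ≤
  -- Sδ/(2e)`.
  have h2 : 3 * μ ^ 2 * S / (8 * κR * κL ^ 2) = 3 * S * δ := by
    rw [hκR]
    field_simp
  rw [h2] at h1
  have h3 : t ≤ 1 / (6 * e) * (3 * S * δ) := by
    refine h1.trans ?_
    gcongr
    exact sub_le_self _ (by positivity)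
  calc 2 / S * (t * e) ≤ 2 / S * (1 / (6 * e) * (3 * S * δ) * e) := by gcongr
    _ = δ := by field_simp; norm_num

end Convergence

end RNGD

/-! ### Choice of the constants and conclusion. -/

theorem theorem5p2
    {E : Type*} [NormedAddCommGroup E] [InnerProductSpace ℝ E] [FiniteDimensional ℝ E]
    {X : Type*} {N q : ℕ}
    (M : Set E) (hM : RNGD.IsEmbeddedSubmanifold M) (hM_closed : IsClosed M)
    (f : X → E → RNGD.Out q) (x : Fin N → X)
    (hf : ∀ i, ∀ θ ∈ M, ContDiffAt ℝ 1 (f (x i)) θ)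
    (θ₀ : E) (hθ₀ : θ₀ ∈ M)
    (μ κL κH : ℝ) (hμ : 0 < μ) (hκL : 0 < κL) (hκH : 0 < κH) :
    ∃ κR : ℝ, 0 < κR ∧
      -- (a) linear convergence
      (∀ (ν : Measure (RNGD.Out q)) (p : RNGD.Out q → RNGD.Out q → ℝ) (y : RNGD.Stack N q),
        RNGD.Assumptions M f x θ₀ μ κL κH ν p y →
        ‖RNGD.output f x θ₀ - y‖ < μ / (3 * κH) →
        ∀ t : ℝ, RNGD.StepSizeOK μ κL κH κR (RNGD.sigmaZero M f x θ₀)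
          ‖RNGD.output f x θ₀ - y‖ t →
        ∀ θ : ℕ → E, θ 0 = θ₀ → RNGD.IsRNGDSequence M ν p f x y t θ →
        ∀ k, ‖RNGD.output f x (θ (k + 1)) - y‖
          ≤ (1 - t / 2) * ‖RNGD.output f x (θ k) - y‖) ∧
      -- (b) quadratic convergence for the unit step size
      (∀ κJ : ℝ, 0 ≤ κJ →
        (∀ θ ∈ M, ∀ θ' ∈ M,
          ‖RNGD.riemJacobian M (RNGD.output f x) θ - RNGD.riemJacobian M (RNGD.output f x) θ'‖
            ≤ κJ * ‖θ - θ'‖) →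
        ∃ κq : ℝ, 0 < κq ∧
          ∀ (ν : Measure (RNGD.Out q)) (p : RNGD.Out q → RNGD.Out q → ℝ) (y : RNGD.Stack N q),
            RNGD.Assumptions M f x θ₀ μ κL κH ν p y →
            ‖RNGD.output f x θ₀ - y‖ < μ / (3 * κH) →
            RNGD.StepSizeOK μ κL κH κR (RNGD.sigmaZero M f x θ₀)
              ‖RNGD.output f x θ₀ - y‖ 1 →
            ∀ θ : ℕ → E, θ 0 = θ₀ → RNGD.IsRNGDSequence M ν p f x y 1 θ →
            ∀ k, ‖RNGD.output f x (θ (k + 1)) - y‖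
              ≤ κq * ‖RNGD.output f x (θ k) - y‖ ^ 2) := by
  -- If `σ₀` is not positive no model satisfies the assumptions, so any constants do.
  by_cases hS : 0 < RNGD.sigmaZero M f x θ₀
  swap
  · refine ⟨1, one_pos, fun ν p y ha => absurd ha.stable.sigma_pos hS, fun κJ _ _ =>
      ⟨1, one_pos, fun ν p y ha => absurd ha.stable.sigma_pos hS⟩⟩
  set S := RNGD.sigmaZero M f x θ₀
  set J := RNGD.riemJacobian M (RNGD.output f x)
  have hu : ∀ θ ∈ M, ContDiffAt ℝ 1 (RNGD.output f x) θ := fun θ hθ =>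
    RNGD.contDiffAt_output fun i => hf i θ hθ
  set B := ‖J θ₀‖ + S with hB
  have hBpos : 0 < B := by positivity
  -- The radius uses the upper bound on `‖u⁰ - y‖` instead of its value, so that the constants do
  -- not depend on `p` and `y`.
  obtain ⟨C, hC, hCε⟩ := RNGD.exists_geodesic_expansion hM hM_closed hu θ₀
    (4 / S * (μ / (3 * κH)))
  obtain ⟨δ', hδ', hδ'c⟩ := hCε (S / 24) (by positivity)
  -- Half of the budget `S/12` goes to the variation of `J`, half to curvature; `C + 1` avoids
  -- division by zero.
  set δ := min δ' (S / (24 * (B * (C + 1))))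
  have hδ : 0 < δ := by positivity
  have hBCδ : B * C * δ ≤ S / 24 := by
    have h1 : δ ≤ S / (24 * (B * (C + 1))) := min_le_right _ _
    rw [le_div_iff₀ (by positivity)] at h1
    nlinarith [mul_pos hBpos hδ]
  have hJB : ∀ (ν : Measure (RNGD.Out q)) (p : RNGD.Out q → RNGD.Out q → ℝ)
      (y : RNGD.Stack N q), RNGD.Assumptions M f x θ₀ μ κL κH ν p y → ∀ θ ∈ M,
      ‖θ - θ₀‖ ≤ 4 / S * ‖RNGD.output f x θ₀ - y‖ → ‖J θ‖ ≤ B := by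
    intro ν p y ha θ hθ hnear
    have h1 := ha.norm_riemJacobian_sub_le hμ hθ hnear
    have h2 := norm_le_norm_add_norm_sub' (J θ) (J θ₀)
    linarith
  have hrad : ∀ y : RNGD.Stack N q, ‖RNGD.output f x θ₀ - y‖ < μ / (3 * κH) →
      4 / S * ‖RNGD.output f x θ₀ - y‖ ≤ 4 / S * (μ / (3 * κH)) := fun y hy => by gcongr
  have hexpand : ∀ (ν : Measure (RNGD.Out q)) (p : RNGD.Out q → RNGD.Out q → ℝ)
      (y : RNGD.Stack N q), RNGD.Assumptions M f x θ₀ μ κL κH ν p y →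
      ‖RNGD.output f x θ₀ - y‖ < μ / (3 * κH) → ∀ c : ℝ → E, RNGD.IsGeodesic M c →
      ‖c 0 - θ₀‖ ≤ 4 / S * ‖RNGD.output f x θ₀ - y‖ → ‖deriv c 0‖ ≤ δ →
      ‖RNGD.output f x (c 1) - RNGD.output f x (c 0) - J (c 0) (deriv c 0)‖
        ≤ S / 12 * ‖deriv c 0‖ := by
    intro ν p y ha hy c hc hnear hξ
    obtain ⟨h1, h2⟩ := hδ'c c hc (hnear.trans (hrad y hy)) (hξ.trans (min_le_left _ _))
    refine (hc.norm_image_sub_sub_le hu (hJB ν p y ha _ (hc.mem 0) hnear) hC h2 h1).trans ?_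
    gcongr
    calc S / 24 + B * C * ‖deriv c 0‖ ≤ S / 24 + B * C * δ := by gcongr
      _ ≤ S / 12 := by linarith
  refine ⟨μ ^ 2 / (8 * κL ^ 2 * δ), by positivity, ?_, ?_⟩
  · intro ν p y ha hy t ht θ h0 hseq k
    exact (ha.linear_convergence hμ hκH hθ₀ hy ht.1 ht.2.1 (hexpand ν p y ha hy)
      (ht.step_length_le hμ hκL hκH hS hδ (norm_nonneg _) rfl) h0 hseq k).2.2.2
  · intro κJ hκJ hlip
    refine ⟨κH / μ + (κJ + B * C) * (2 / S) ^ 2, by positivity, ?_⟩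
    intro ν p y ha hy ht θ h0 hseq k
    have hδ1 := ht.step_length_le hμ hκL hκH hS hδ (norm_nonneg _) rfl
    obtain ⟨hk, hek, hnear, -⟩ := ha.linear_convergence hμ hκH hθ₀ hy ht.1 ht.2.1
      (hexpand ν p y ha hy) hδ1 h0 hseq k
    have hsmall : κH / μ * ‖RNGD.output f x (θ k) - y‖ ≤ 1 / 3 := by
      have h1 := hek.trans_lt hy
      rw [lt_div_iff₀ (by positivity)] at h1
      rw [div_mul_eq_mul_div, div_le_iff₀ hμ]
      linarith
    obtain ⟨A, hA, hexp⟩ := hseq k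
    obtain ⟨c, hc, hc0, hc1, hξ, hlin⟩ :=
      ha.exists_geodesic_of_step hμ hκH hk hnear hsmall one_pos hA hexp
    have hξδ : ‖deriv c 0‖ ≤ δ := hξ.trans (le_trans (by gcongr) hδ1)
    have hnear0 : ‖c 0 - θ₀‖ ≤ 4 / S * ‖RNGD.output f x θ₀ - y‖ := by rwa [hc0]
    have hcurv := (hδ'c c hc (hnear0.trans (hrad y hy)) (hξδ.trans (min_le_left _ _))).2
    -- With Lipschitz `J` the variation `ε` is itself of order `‖ξ‖`, so the expansion error becomes
    -- quadratic.
    have hE := hc.norm_image_sub_sub_le hu (hJB ν p y ha _ (hc.mem 0) hnear0) hC hcurv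
      (ε := κJ * ‖deriv c 0‖) (fun s hs => (hlip _ (hc.mem s) _ (hc.mem 0)).trans
        (by gcongr; exact hc.norm_sub_le hs))
    rw [hc0, hc1] at hE
    rw [one_smul, one_mul] at hlin
    rw [one_mul] at hξ
    set u := RNGD.output f x (θ k)
    set u' := RNGD.output f x (θ (k + 1))
    calc ‖u' - y‖ = ‖(u' - u - J (θ k) (deriv c 0)) + (J (θ k) (deriv c 0) + (u - y))‖ := by
          congr 1
          abel
      _ ≤ (κJ * ‖deriv c 0‖ + B * C * ‖deriv c 0‖) * ‖deriv c 0‖ + κH / μ * ‖u - y‖ ^ 2 :=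
          (norm_add_le _ _).trans (add_le_add hE hlin)
      _ = (κJ + B * C) * ‖deriv c 0‖ ^ 2 + κH / μ * ‖u - y‖ ^ 2 := by ring
      _ ≤ (κJ + B * C) * (2 / S * ‖u - y‖) ^ 2 + κH / μ * ‖u - y‖ ^ 2 := by gcongr
      _ = (κH / μ + (κJ + B * C) * (2 / S) ^ 2) * ‖u - y‖ ^ 2 := by ring
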